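/- \textbf{Theorem 3 (contrastive block-identification).} Let $X=l(\epsilon_X)\in\mathbb R^k$, $T_C=g(X,\epsilon_{T_C})\in\mathbb R^m$, $T_{nC}=h(X,\epsilon_{T_{nC}})\in\mathbb R^d$, $T=\mathrm{mix}(T_C,T_{nC})\in\mathcal T\subseteq\mathbb R^D$ and $Y=f(T_C,X)\in\mathbb R^m$ be a structural causal model with independent noises $\epsilon_X\in\mathbb R^k$, $\epsilon_{T_C}\in\mathbb R^m$, $\epsilon_{T_{nC}}\in\mathbb R^d$, where $\mathcal T=\mathrm{mix}(\mathbb R^m\times\mathbb R^d)$. Assume that each noise has a smooth Lebesgue density that is positive almost everywhere; that $l,g,h,\mathrm{mix},f$ are smooth; that $l$ and, for every $x$, the maps $g(x,\cdot)$, $h(x,\cdot)$ and $f(\cdot,x)$ are smooth diffeomorphisms of $\mathbb R^k$, $\mathbb R^m$, $\mathbb R^d$ and $\mathbb R^m$ respectively; and that $\mathrm{mix}$ is injective with an inverse that is smooth on its image $\mathcal T$. A \emph{positive pair} consists of two treatments $T\neq T'$ that are drawn independently given common values of $X$ and $Y$; a \emph{negative pair} consists of two pairs $(T,Y),(T',Y')$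 drawn independently given a common value of $X$, conditioned on $T\ne T'$ and $Y\neq Y'$. Let $a:[0,\infty)\to[0,\infty)$ be continuous with $a(t)=0\iff t=0$, and let $b(x,y,y',t)\ge 0$ be continuous on $\mathbb R^k\times\mathbb R^m\times\mathbb R^m\times[0,\infty)$, nonincreasing in $t$, with $b(x,y,y',t)\to0$ as $t\to\infty$ whenever $y\neq y'$, and with $\mathbb E_{\mathrm{neg}}\,b(X,Y,Y',0)<\infty$. For a representation $\psi$ of the treatment, consider the contrastive loss $$L_{a,b}(\psi)=\mathbb E_{\mathrm{pos}}\,a\big(\|\psi(T)-\psi(T')\|\big)+\mathbb E_{\mathrm{neg}}\,b\big(X,Y,Y',\|\psi(T)-\psi(T')\|\big).$$ (An expectation is read as $0$ if pairs of that kind have probability $0$.) 1. If moreover $b(x,y,y',0)>0$ whenever $y\ne y'$, and $r\ge m$, then every minimizer $\psi$ of $L_{a,b}$ among the smooth maps $\mathcal T\to\mathbb R^r$ block-identifies the causal latents: there is a map $\phi:\mathbb R^m\to\mathbb R^r$, invertible onto its image, with $\psi(\mathrm{mix}(c,n))=\phi(c)$ for all $c\in\mathbb R^m$, $n\in\mathbb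 R^d$, that is, $\psi(T)=\phi(T_C)$. 2. Without the additional condition on $b$ (so that $b=0$ is allowed): if $\Psi=(\Psi_1,\Psi_2):\mathcal T\to\mathbb R^m\times\mathbb R^d$ is a diffeomorphism whose first block $\Psi_1$ minimizes $L_{a,b}$ among the first blocks of all such diffeomorphisms, then there is a bijection $\phi:\mathbb R^m\to\mathbb R^m$ with $\Psi_1(\mathrm{mix}(c,n))=\phi(c)$ for all $c,n$. 3. Minimizers exist: there is a function $b$ satisfying all the conditions above, including the one in part 1, such that for every $a$ as above the loss $L_{a,b}$ has a minimizer among the smooth maps $\mathcal T\to\mathbb R^r$ for every $r\ge m$, and a minimizing diffeomorphism as in part 2. -/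

import Mathlib

open MeasureTheory ProbabilityTheory Set Filter
open scoped ContDiff NNReal ENNReal Topology

noncomputable section

/-- The Euclidean space `ℝⁿ`. -/
abbrev Vec (n : ℕ) : Type := EuclideanSpace ℝ (Fin n)

/-- `f` is smooth and invertible with smooth inverse. -/
def IsSmoothDiffeo {E F : Type*} [NormedAddCommGroup E] [NormedSpace ℝ E]
    [NormedAddCommGroup F] [NormedSpace ℝ F] (f : E → F) : Prop :=
  ContDiff ℝ ∞ f ∧
    ∃ g : F → E, ContDiff ℝ ∞ g ∧ Function.LeftInverse g f ∧ Function.RightInverse g f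

/-- `f` is smooth and invertible onto its image, with an inverse that is smooth on the image. -/
def IsSmoothDiffeoOntoImage {E F : Type*} [NormedAddCommGroup E] [NormedSpace ℝ E]
    [NormedAddCommGroup F] [NormedSpace ℝ F] (f : E → F) : Prop :=
  ContDiff ℝ ∞ f ∧
    ∃ g : F → E, ContDiffOn ℝ ∞ g (range f) ∧ Function.LeftInverse g f

/-- A probability law with a smooth Lebesgue density that is positive almost everywhere. -/
def IsSmoothPositiveLaw {n : ℕ} (P : ProbabilityMeasure (Vec n)) : Prop :=
  ∃ p : Vec n → ℝ, ContDiff ℝ ∞ p ∧ (∀ e, 0 ≤ p e) ∧ (∀ᵐ e, 0 < p e) ∧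
    (P : Measure (Vec n)) = volume.withDensity (fun e => ENNReal.ofReal (p e))

/-- The structural causal model
`X = l(ε_X)`, `T_C = g(X, ε_C)`, `T_nC = h(X, ε_nC)`, `T = mix(T_C, T_nC)`, `Y = f(T_C, X)`
with its noise laws. Dimensions: `X` has `k`, `T_C` has `m`, `T_nC` has `d`, `T` lives in `ℝ^D`. -/
structure TreatmentSCM (k m d D : ℕ) where
  l : Vec k → Vec k
  g : Vec k × Vec m → Vec m
  h : Vec k × Vec d → Vec d
  mix : Vec m × Vec d → Vec D
  f : Vec m × Vec k → Vec m
  noiseX : ProbabilityMeasure (Vec k)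
  noiseC : ProbabilityMeasure (Vec m)
  noiseN : ProbabilityMeasure (Vec d)

namespace TreatmentSCM

variable {k m d D : ℕ} (S : TreatmentSCM k m d D)

/-- All structural functions are smooth and invertible with smooth inverses (`g`, `h` in the noise
and `f` in the causal latents, for each value of the covariates), and all noise laws have smooth,
almost everywhere positive densities. -/
structure Regular : Prop where
  l_diffeo : IsSmoothDiffeo S.l
  g_smooth : ContDiff ℝ ∞ S.g
  g_diffeo : ∀ x, IsSmoothDiffeo fun e => S.g (x, e)
  h_smooth : ContDiff ℝ ∞ S.h
  h_diffeo : ∀ x, IsSmoothDiffeo fun e => S.h (x, e)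
  mix_diffeo : IsSmoothDiffeoOntoImage S.mix
  f_smooth : ContDiff ℝ ∞ S.f
  f_diffeo : ∀ x, IsSmoothDiffeo fun c => S.f (c, x)
  noiseX_law : IsSmoothPositiveLaw S.noiseX
  noiseC_law : IsSmoothPositiveLaw S.noiseC
  noiseN_law : IsSmoothPositiveLaw S.noiseN

/-- The joint law of the independent noises `(ε_X, ε_C, ε_nC)`. -/
def noiseLaw : Measure (Vec k × Vec m × Vec d) :=
  (S.noiseX : Measure (Vec k)).prod
    ((S.noiseC : Measure (Vec m)).prod (S.noiseN : Measure (Vec d)))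

instance : IsProbabilityMeasure S.noiseLaw := by
  unfold noiseLaw; infer_instance

/-- Covariates. -/
def X (e : Vec k × Vec m × Vec d) : Vec k := S.l e.1

/-- Causal latents. -/
def TC (e : Vec k × Vec m × Vec d) : Vec m := S.g (S.X e, e.2.1)

/-- Non-causal latents. -/
def TN (e : Vec k × Vec m × Vec d) : Vec d := S.h (S.X e, e.2.2)

/-- Observed treatment. -/
def T (e : Vec k × Vec m × Vec d) : Vec D := S.mix (S.TC e, S.TN e)

/-- Outcome. -/
def Y (e : Vec k × Vec m × Vec d) : Vec m := S.f (S.TC e, S.X e)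

/-- Law of a positive pair `((X, Y), (T, T'))`: draw `(X, Y)`, then two independent treatments from
the conditional law of the treatment given `(X, Y)`, and condition on `T ≠ T'`. -/
def posPairLaw : Measure ((Vec k × Vec m) × (Vec D × Vec D)) :=
  ProbabilityTheory.cond
    ((S.noiseLaw.map fun e => (S.X e, S.Y e)) ⊗ₘ
      (condDistrib S.T (fun e => (S.X e, S.Y e)) S.noiseLaw ×ₖ
        condDistrib S.T (fun e => (S.X e, S.Y e)) S.noiseLaw))
    {p | p.2.1 ≠ p.2.2}

/-- Law of a negative pair `(X, ((T, Y), (T', Y')))`: draw `X`, then two independent copies of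
treatment and outcome from their conditional law given `X`, and condition on `T ≠ T'`, `Y ≠ Y'`. -/
def negPairLaw : Measure (Vec k × ((Vec D × Vec m) × (Vec D × Vec m))) :=
  ProbabilityTheory.cond
    ((S.noiseLaw.map S.X) ⊗ₘ
      (condDistrib (fun e => (S.T e, S.Y e)) S.X S.noiseLaw ×ₖ
        condDistrib (fun e => (S.T e, S.Y e)) S.X S.noiseLaw))
    {p | p.2.1.1 ≠ p.2.2.1 ∧ p.2.1.2 ≠ p.2.2.2}

/-- `a` is a penalty on the distance of the two representations of a positive pair. -/
structure IsAttraction (a : ℝ≥0 → ℝ≥0) : Prop where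
  continuous : Continuous a
  eq_zero_iff : ∀ t, a t = 0 ↔ t = 0

/-- `b (x, y, y', t)` penalizes a negative pair with covariates `x` and outcomes `y ≠ y'` whose
representations have distance `t`: the penalty decreases to zero as the distance grows, and the
penalty of a collapsed representation has finite mean. -/
structure IsRepulsion (b : Vec k × Vec m × Vec m × ℝ≥0 → ℝ≥0) : Prop where
  continuous : Continuous b
  antitone : ∀ x y y', Antitone fun t => b (x, y, y', t)
  tendsto : ∀ x y y', y ≠ y' → Tendsto (fun t => b (x, y, y', t)) atTop (𝓝 0)
  integrable : ∫⁻ p, (b (p.1, p.2.1.2, p.2.2.2, 0) : ℝ≥0∞) ∂S.negPairLaw ≠ ⊤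

/-- Giving both members of a negative pair the same representation is penalized. -/
def PenalizesCollapse (b : Vec k × Vec m × Vec m × ℝ≥0 → ℝ≥0) : Prop :=
  ∀ x y y', y ≠ y' → 0 < b (x, y, y', 0)

/-- The population contrastive loss of a representation `ψ` of the treatment. -/
def contrastiveLoss (a : ℝ≥0 → ℝ≥0) (b : Vec k × Vec m × Vec m × ℝ≥0 → ℝ≥0) {r : ℕ}
    (ψ : Vec D → Vec r) : ℝ≥0∞ :=
  (∫⁻ p, (a (nndist (ψ p.2.1) (ψ p.2.2)) : ℝ≥0∞) ∂S.posPairLaw) +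
    ∫⁻ p, (b (p.1, p.2.1.2, p.2.2.2, nndist (ψ p.2.1.1) (ψ p.2.2.1)) : ℝ≥0∞) ∂S.negPairLaw

/-- `ψ` is smooth on the treatment space and minimizes the contrastive loss among all such maps. -/
def IsContrastiveMinimizer (a : ℝ≥0 → ℝ≥0) (b : Vec k × Vec m × Vec m × ℝ≥0 → ℝ≥0) {r : ℕ}
    (ψ : Vec D → Vec r) : Prop :=
  ContDiffOn ℝ ∞ ψ (range S.mix) ∧
    ∀ ψ' : Vec D → Vec r, ContDiffOn ℝ ∞ ψ' (range S.mix) →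
      S.contrastiveLoss a b ψ ≤ S.contrastiveLoss a b ψ'

/-- `Ψ` restricts to a diffeomorphism from the treatment space onto `ℝ^m × ℝ^d`. -/
def IsInvertibleEncoder (Ψ : Vec D → Vec m × Vec d) : Prop :=
  ContDiffOn ℝ ∞ Ψ (range S.mix) ∧
    ∃ Θ : Vec m × Vec d → Vec D, ContDiff ℝ ∞ Θ ∧ (∀ z, Θ z ∈ range S.mix) ∧
      (∀ z, Ψ (Θ z) = z) ∧ ∀ t ∈ range S.mix, Θ (Ψ t) = t

/-- `Ψ` is an invertible encoder whose first block minimizes the contrastive loss among the first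
blocks of all invertible encoders. -/
def IsInvertibleContrastiveMinimizer (a : ℝ≥0 → ℝ≥0)
    (b : Vec k × Vec m × Vec m × ℝ≥0 → ℝ≥0) (Ψ : Vec D → Vec m × Vec d) : Prop :=
  S.IsInvertibleEncoder Ψ ∧
    ∀ Ψ' : Vec D → Vec m × Vec d, S.IsInvertibleEncoder Ψ' →
      S.contrastiveLoss a b (fun t => (Ψ t).1) ≤ S.contrastiveLoss a b (fun t => (Ψ' t).1)

/-- `ψ(T) = φ(T_C)` for a map `φ` that is invertible (as a map onto its image). -/
def BlockIdentifies {r : ℕ} (ψ : Vec D → Vec r) : Prop :=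
  ∃ φ : Vec m → Vec r, Function.Injective φ ∧ ∀ c n, ψ (S.mix (c, n)) = φ c

end TreatmentSCM

end

/-! The infimum of the loss is zero. The representations `s • T_C` (embedded in `ℝ^r` when `m ≤ r`)
make the attraction term vanish. As `s → ∞` their repulsion term tends to zero by dominated
convergence, the penalty at distance zero being the integrable bound
(`tendsto_contrastiveLoss_of_scaling`). Hence every minimizer has zero loss.

Zero loss is then read pointwise. Each pair law is the image of a product of noise laws of full
support under a continuous map, conditioned on an open event (`posPairLaw_eq`, `negPairLaw_eq`), so
a continuous nonnegative integrand of mean zero vanishes on the whole event. As `f (·, x)` is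
injective, a positive pair shares its causal latents, and attraction forces the representation to
ignore the non-causal ones. Repulsion separates distinct causal latents if collapse is penalized.

Without that condition, invertibility comes from the encoder: a first block `φ` that depends on `c`
alone is bijective (`bijective_of_fst_block`). For existence, `exists_repulsion` builds a penalty
for which `T_C` itself has zero loss. -/

noncomputable section

/-! ### Conditional laws generated by an independent noise. -/

section Kernels

variable {A B Z W Ω : Type*} [MeasurableSpace A] [MeasurableSpace B] [MeasurableSpace Z]
  [MeasurableSpace W] [MeasurableSpace Ω]

/-- The kernel `z ↦ law of u (z, ε)` for a noise `ε` of law `N`. -/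
def noiseKernel (N : Measure B) (u : Z × B → W) : Kernel Z W :=
  (Kernel.id ×ₖ Kernel.const Z N).map u

lemma noiseKernel_apply (N : Measure B) [IsProbabilityMeasure N] {u : Z × B → W}
    (hu : Measurable u) (z : Z) : noiseKernel N u z = N.map fun b => u (z, b) := by
  rw [noiseKernel, Kernel.map_apply _ hu, Kernel.prod_apply, Kernel.id_apply, Kernel.const_apply,
    Measure.dirac_prod, Measure.map_map hu measurable_prodMk_left]
  rfl

lemma isMarkovKernel_noiseKernel (N : Measure B) [IsProbabilityMeasure N] {u : Z × B → W}
    (hu : Measurable u) : IsMarkovKernel (noiseKernel N u : Kernel Z W) :=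
  Kernel.IsMarkovKernel.map _ hu

lemma map_compProd_noiseKernel (ν : Measure A) [IsProbabilityMeasure ν] (N : Measure B)
    [IsProbabilityMeasure N] {q : A → Z} (hq : Measurable q) {u : Z × B → W} (hu : Measurable u) :
    (ν.map q) ⊗ₘ (noiseKernel N u) = (ν.prod N).map fun p => (q p.1, u (q p.1, p.2)) := by
  have := isMarkovKernel_noiseKernel (Z := Z) N hu
  have : IsProbabilityMeasure (ν.map q) := Measure.isProbabilityMeasure_map hq.aemeasurable
  refine Measure.ext_of_lintegral _ fun F hF => ?_
  rw [Measure.lintegral_compProd hF, lintegral_map hF (by fun_prop),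
    lintegral_prod _ (by fun_prop), lintegral_map _ hq]
  · refine lintegral_congr fun a => ?_
    rw [noiseKernel_apply N hu, lintegral_map (by fun_prop) (by fun_prop)]
  · exact Measurable.lintegral_kernel_prod_right' hF

lemma noiseKernel_prod_self (N : Measure B) [IsProbabilityMeasure N] {u : Z × B → W}
    (hu : Measurable u) :
    noiseKernel N u ×ₖ noiseKernel N u =
      noiseKernel (N.prod N) fun p : Z × (B × B) => (u (p.1, p.2.1), u (p.1, p.2.2)) := by
  have := isMarkovKernel_noiseKernel (Z := Z) N hu
  ext1 z
  rw [Kernel.prod_apply, noiseKernel_apply N hu, noiseKernel_apply (N.prod N) (by fun_prop),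
    Measure.map_prod_map _ _ (by fun_prop) (by fun_prop)]
  rfl

/-- If `V` is a function of `α` and `T` a function of `V` and a noise `β` independent of `α`, then
two conditionally independent copies of `T` given `V` are obtained by drawing the noise twice. -/
lemma compProd_condDistrib_prod_self [StandardBorelSpace W] [Nonempty W]
    (μ : Measure Ω) [IsProbabilityMeasure μ] (ν : Measure A) [IsProbabilityMeasure ν]
    (N : Measure B) [IsProbabilityMeasure N] {α : Ω → A × B}
    (hα : MeasurePreserving α μ (ν.prod N)) {q : A → Z} (hq : Measurable q)
    {u : Z × B → W} (hu : Measurable u) {V : Ω → Z} {T : Ω → W}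
    (hV : ∀ e, V e = q (α e).1) (hT : ∀ e, T e = u (V e, (α e).2)) :
    (μ.map V) ⊗ₘ (condDistrib T V μ ×ₖ condDistrib T V μ) =
      (ν.prod (N.prod N)).map
        fun p => (q p.1, (u (q p.1, p.2.1), u (q p.1, p.2.2))) := by
  have := isMarkovKernel_noiseKernel (Z := Z) N hu
  have hαm := hα.measurable
  obtain rfl : V = fun e => q (α e).1 := funext hV
  obtain rfl : T = fun e => u (q (α e).1, (α e).2) := funext hT
  have hmap : μ.map (fun e => q (α e).1) = ν.map q := by
    have : (fun e => q (α e).1) = (fun p : A × B => q p.1) ∘ α := rfl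
    rw [this, ← Measure.map_map (by fun_prop) hαm, hα.map_eq]
    have : (fun p : A × B => q p.1) = q ∘ Prod.fst := rfl
    rw [this, ← Measure.map_map hq measurable_fst, Measure.map_fst_prod]
    simp
  have hK : condDistrib (fun e => u (q (α e).1, (α e).2)) (fun e => q (α e).1) μ
      =ᵐ[μ.map fun e => q (α e).1] noiseKernel N u := by
    -- Disintegrations are almost everywhere unique, so it suffices that the noise kernel reproduces
    -- the joint law of `V` and `T`.
    refine condDistrib_ae_eq_of_measure_eq_compProd _ (by fun_prop) ?_
    rw [hmap, map_compProd_noiseKernel ν N hq hu, ← hα.map_eq,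
      Measure.map_map (by fun_prop) hαm]
    rfl
  have hKK : (condDistrib (fun e => u (q (α e).1, (α e).2)) (fun e => q (α e).1) μ ×ₖ
        condDistrib (fun e => u (q (α e).1, (α e).2)) (fun e => q (α e).1) μ)
      =ᵐ[μ.map fun e => q (α e).1] noiseKernel N u ×ₖ noiseKernel N u := by
    filter_upwards [hK] with z hz
    rw [Kernel.prod_apply, Kernel.prod_apply, hz]
  rw [Measure.compProd_congr hKK, noiseKernel_prod_self N hu, hmap,
    map_compProd_noiseKernel ν (N.prod N) hq (by fun_prop)]

lemma cond_map_of_measurable {ρ : Measure A} {Φ : A → Z} (hΦ : Measurable Φ) {s : Set Z}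
    (hs : MeasurableSet s) :
    ProbabilityTheory.cond (ρ.map Φ) s = (ProbabilityTheory.cond ρ (Φ ⁻¹' s)).map Φ := by
  rw [ProbabilityTheory.cond, ProbabilityTheory.cond, Measure.restrict_map hΦ hs,
    Measure.map_apply hΦ hs, Measure.map_smul]

end Kernels

/-! ### Laws of full support. -/

/-- A continuous function whose mean over an event that is open vanishes is zero on the event. -/
lemma eq_zero_of_lintegral_cond_eq_zero {A : Type*} [TopologicalSpace A] [MeasurableSpace A]
    [OpensMeasurableSpace A] {ρ : Measure A} [IsFiniteMeasure ρ] [ρ.IsOpenPosMeasure]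
    {U : Set A} (hU : IsOpen U) {F : A → ℝ≥0∞} (hF : Continuous F)
    (h : ∫⁻ e, F e ∂(ProbabilityTheory.cond ρ U) = 0) {e : A} (he : e ∈ U) : F e = 0 := by
  rw [ProbabilityTheory.cond, lintegral_smul_measure, smul_eq_mul, mul_eq_zero] at h
  have h0 : ∫⁻ e in U, F e ∂ρ = 0 :=
    h.resolve_left (ENNReal.inv_ne_zero.2 (measure_ne_top ρ U))
  rw [lintegral_eq_zero_iff hF.measurable, Filter.EventuallyEq, ae_restrict_iff'
    hU.measurableSet] at h0
  by_contra hne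
  have hopen : IsOpen (U ∩ {e | F e ≠ 0}) := hU.inter (isOpen_ne_fun hF continuous_const)
  refine hopen.measure_ne_zero ρ ⟨e, he, hne⟩ (measure_mono_null ?_ (ae_iff.1 h0))
  rintro x ⟨hx, hx0⟩ hc
  exact hx0 (hc hx)

/-- An almost everywhere positive density makes Lebesgue measure absolutely continuous with respect
to the law. -/
lemma IsSmoothPositiveLaw.isOpenPosMeasure {n : ℕ} {P : ProbabilityMeasure (Vec n)}
    (hP : IsSmoothPositiveLaw P) : (P : Measure (Vec n)).IsOpenPosMeasure := by
  obtain ⟨p, hp, -, hpos, hPp⟩ := hP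
  rw [hPp]
  refine Measure.AbsolutelyContinuous.isOpenPosMeasure
    (withDensity_absolutelyContinuous' (μ := (volume : Measure (Vec n))) ?_ ?_)
  · exact (ENNReal.continuous_ofReal.comp hp.continuous).measurable.aemeasurable
  · filter_upwards [hpos] with e he
    simpa using he

/-! ### Inverse functions with parameters and block maps. -/

/-- A smooth family of diffeomorphisms has a jointly continuous family of inverses. -/
lemma exists_continuous_parametric_inverse {E F : Type*} [NormedAddCommGroup E] [NormedSpace ℝ E]
    [NormedAddCommGroup F] [NormedSpace ℝ F] [FiniteDimensional ℝ E] [FiniteDimensional ℝ F]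
    {f : E × F → E} (hf : ContDiff ℝ ∞ f) (hd : ∀ x, IsSmoothDiffeo fun c => f (c, x)) :
    ∃ φ : F × E → E, Continuous φ ∧ (∀ x c, φ (x, f (c, x)) = c) ∧ ∀ x y, f (φ (x, y), x) = y := by
  have : CompleteSpace E := FiniteDimensional.complete ℝ E
  have : CompleteSpace F := FiniteDimensional.complete ℝ F
  choose hs φ hφs hl hr using hd
  let G : E × F → E × F := fun p => (f p, p.2)
  have hG : ContDiff ℝ ∞ G := hf.prodMk contDiff_snd
  -- The derivative of `G` is block triangular: a kernel vector has `v = 0`, and the partial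
  -- derivative in `c` is injective by the chain rule applied to `φ x ∘ f (·, x) = id`.
  have hinj : ∀ p, Function.Injective (fderiv ℝ G p) := by
    rintro ⟨c, x⟩
    rw [injective_iff_map_eq_zero]
    rintro ⟨u, v⟩ h
    have hfd : HasFDerivAt f (fderiv ℝ f (c, x)) (c, x) :=
      (hf.differentiable (by simp) _).hasFDerivAt
    have hGd : HasFDerivAt G ((fderiv ℝ f (c, x)).prod (ContinuousLinearMap.snd ℝ E F)) (c, x) :=
      hfd.prodMk hasFDerivAt_snd
    rw [hGd.fderiv] at h
    obtain ⟨h1, rfl⟩ : fderiv ℝ f (c, x) (u, v) = 0 ∧ v = 0 := by simpa using h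
    have h2 : HasFDerivAt (fun c => f (c, x))
        ((fderiv ℝ f (c, x)).comp (ContinuousLinearMap.inl ℝ E F)) c :=
      hfd.comp c (hasFDerivAt_prodMk_left c x)
    have h3 : HasFDerivAt (φ x) (fderiv ℝ (φ x) (f (c, x))) (f (c, x)) :=
      ((hφs x).differentiable (by simp) _).hasFDerivAt
    have h4 := h3.comp c h2
    have h5 : (φ x ∘ fun c => f (c, x)) = id := funext (hl x)
    rw [h5] at h4
    have h6 := congrArg (fun L : E →L[ℝ] E => L u) (h4.unique (hasFDerivAt_id c))
    simp only [ContinuousLinearMap.comp_apply, ContinuousLinearMap.inl_apply, h1, map_zero,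
      ContinuousLinearMap.id_apply] at h6
    rw [← h6]
    rfl
  have hbij : Function.Bijective G := by
    constructor
    · rintro ⟨c, x⟩ ⟨c', x'⟩ h
      obtain ⟨h1, rfl⟩ : f (c, x) = f (c', x') ∧ x = x' := by simpa [G] using h
      exact Prod.ext ((hl x).injective h1) rfl
    · rintro ⟨y, x⟩
      exact ⟨(φ x y, x), Prod.ext (hr x y) rfl⟩
  -- Injective endomorphisms in finite dimension are equivalences, so the inverse function theorem
  -- makes the bijection `G` a homeomorphism.
  have hopen : IsOpenMap G :=
    isOpenMap_of_hasStrictFDerivAt_equiv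
      (f' := fun p => (LinearEquiv.ofInjectiveEndo (fderiv ℝ G p : E × F →ₗ[ℝ] E × F)
        (hinj p)).toContinuousLinearEquiv)
      fun p => by
        convert hG.contDiffAt.hasStrictFDerivAt (by simp) using 1
        rfl
  let e : E × F ≃ₜ E × F :=
    (Equiv.ofBijective G hbij).toHomeomorphOfContinuousOpen hG.continuous hopen
  refine ⟨fun p => φ p.1 p.2, ?_, fun x c => hl x c, fun x y => hr x y⟩
  have : (fun p : F × E => φ p.1 p.2) = fun p => (e.symm (p.2, p.1)).1 := by
    funext p
    have : e.symm (p.2, p.1) = (φ p.1 p.2, p.1) := by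
      rw [e.symm_apply_eq]
      exact Prod.ext (hr p.1 p.2).symm rfl
    rw [this]
  rw [this]
  fun_prop

/-- If a diffeomorphism of a product has a first block depending on the first coordinate only, then
that block is bijective. -/
lemma bijective_of_fst_block {E F : Type*} [NormedAddCommGroup E] [NormedSpace ℝ E]
    [NormedAddCommGroup F] [NormedSpace ℝ F] [FiniteDimensional ℝ E] {Γ G : E × F → E × F}
    (hΓ : ContDiff ℝ ∞ Γ) (hG : ContDiff ℝ ∞ G) (hl : Function.LeftInverse G Γ)
    (hr : Function.RightInverse G Γ) {φ : E → E} (hφ : ∀ c n, (Γ (c, n)).1 = φ c) :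
    Function.Bijective φ := by
  have hφs : ContDiff ℝ ∞ φ := by
    have : φ = fun c => (Γ (c, 0)).1 := funext fun c => (hφ c 0).symm
    rw [this]
    exact contDiff_fst.comp (hΓ.comp (contDiff_id.prodMk contDiff_const))
  have hφG : ∀ z w, φ (G (z, w)).1 = z := fun z w => by
    rw [← hφ _ (G (z, w)).2, Prod.mk.eta, hr]
  refine ⟨fun c₁ c₂ h => ?_, fun z => ⟨_, hφG z 0⟩⟩
  set H : E × F → E := fun p => (G p).1 with hH
  have hHs : ContDiff ℝ ∞ H := contDiff_fst.comp hG
  have hdφ : ∀ c, HasFDerivAt φ (fderiv ℝ φ c) c := fun c =>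
    (hφs.differentiable (by simp) c).hasFDerivAt
  have hdH : ∀ p, HasFDerivAt H (fderiv ℝ H p) p := fun p =>
    (hHs.differentiable (by simp) p).hasFDerivAt
  -- Differentiate `φ (H (z, w)) = z`. In the direction `z` this makes `dφ` surjective, hence
  -- injective; in the direction `w` it then gives `∂H/∂w = 0`.
  have key : ∀ p, (fderiv ℝ φ (H p)).comp (fderiv ℝ H p) = ContinuousLinearMap.fst ℝ E F := by
    intro p
    have h1 := (hdφ (H p)).comp p (hdH p)
    have h2 : φ ∘ H = Prod.fst := funext fun p => hφG p.1 p.2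
    rw [h2] at h1
    exact h1.unique hasFDerivAt_fst
  have hinj : ∀ p, Function.Injective (fderiv ℝ φ (H p)) := by
    intro p
    refine LinearMap.injective_iff_surjective (f := (fderiv ℝ φ (H p) : E →ₗ[ℝ] E)).2 fun u => ?_
    refine ⟨fderiv ℝ H p (u, 0), ?_⟩
    exact congrArg (fun L : E × F →L[ℝ] E => L (u, 0)) (key p)
  have hconst : ∀ z w w', H (z, w) = H (z, w') := by
    intro z
    have hd : ∀ w, HasFDerivAt (fun w => H (z, w)) (0 : F →L[ℝ] E) w := by
      intro w
      have h1 : HasFDerivAt (fun w => H (z, w))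
          ((fderiv ℝ H (z, w)).comp (ContinuousLinearMap.inr ℝ E F)) w :=
        (hdH (z, w)).comp w (hasFDerivAt_prodMk_right z w)
      convert h1
      ext v
      refine (hinj (z, w) ?_).symm
      have := congrArg (fun L : E × F →L[ℝ] E => L (0, v)) (key (z, w))
      simpa using this
    exact is_const_of_fderiv_eq_zero (fun w => (hd w).differentiableAt) fun w => (hd w).fderiv
  -- As `H` does not depend on its second argument, this makes it a left inverse of `φ`.
  have hrec : ∀ c, H (φ c, (Γ (c, 0)).2) = c := fun c => by
    have : (φ c, (Γ (c, 0)).2) = Γ (c, 0) := Prod.ext (hφ c 0).symm rfl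
    rw [this, hH]
    exact congrArg Prod.fst (hl (c, 0))
  rw [← hrec c₁, ← hrec c₂, h]
  exact hconst _ _ _

/-- `ℝ^m` embeds linearly and isometrically into `ℝ^r` for `m ≤ r`. -/
def vecEmbedding {m r : ℕ} (h : m ≤ r) : Vec m →ₗᵢ[ℝ] Vec r :=
  LinearMap.isometryOfOrthonormal
    ((EuclideanSpace.basisFun (Fin m) ℝ).toBasis.constr ℝ
      fun i => EuclideanSpace.basisFun (Fin r) ℝ (Fin.castLE h i))
    (v := (EuclideanSpace.basisFun (Fin m) ℝ).toBasis)
    (by simp)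
    (by
      have : (⇑((EuclideanSpace.basisFun (Fin m) ℝ).toBasis.constr ℝ
          fun i => EuclideanSpace.basisFun (Fin r) ℝ (Fin.castLE h i)) ∘
          (EuclideanSpace.basisFun (Fin m) ℝ).toBasis) =
          fun i => EuclideanSpace.basisFun (Fin r) ℝ (Fin.castLE h i) :=
        funext fun i => Module.Basis.constr_basis _ _ _ _
      rw [this]
      exact (EuclideanSpace.basisFun (Fin r) ℝ).orthonormal.comp _ (Fin.castLE_injective h))

end

noncomputable section

namespace TreatmentSCM

/-! ### Pair laws as images of noise laws. -/

section PairLaws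

variable {k m d D : ℕ} (S : TreatmentSCM k m d D)

/-- The noises of two treatments that share the covariates and the causal latents. -/
def posNoiseLaw : Measure ((Vec k × Vec m) × (Vec d × Vec d)) :=
  ((S.noiseX : Measure (Vec k)).prod (S.noiseC : Measure (Vec m))).prod
    ((S.noiseN : Measure (Vec d)).prod (S.noiseN : Measure (Vec d)))

/-- The noises of two units that share the covariates. -/
def negNoiseLaw : Measure (Vec k × ((Vec m × Vec d) × (Vec m × Vec d))) :=
  (S.noiseX : Measure (Vec k)).prod
    (((S.noiseC : Measure (Vec m)).prod (S.noiseN : Measure (Vec d))).prod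
      ((S.noiseC : Measure (Vec m)).prod (S.noiseN : Measure (Vec d))))

instance : IsProbabilityMeasure S.posNoiseLaw := by unfold posNoiseLaw; infer_instance

instance : IsProbabilityMeasure S.negNoiseLaw := by unfold negNoiseLaw; infer_instance

/-- The causal latents as a function of the noises. -/
def causal (p : Vec k × Vec m) : Vec m := S.g (S.l p.1, p.2)

/-- Covariates, outcome and two treatments with common covariates and causal latents. -/
def posPair (e : (Vec k × Vec m) × (Vec d × Vec d)) : (Vec k × Vec m) × (Vec D × Vec D) :=
  ((S.l e.1.1, S.f (S.causal e.1, S.l e.1.1)),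
    (S.mix (S.causal e.1, S.h (S.l e.1.1, e.2.1)), S.mix (S.causal e.1, S.h (S.l e.1.1, e.2.2))))

/-- Treatment and outcome as a function of the covariates and the remaining noises. -/
def unit (p : Vec k × (Vec m × Vec d)) : Vec D × Vec m :=
  (S.mix (S.g (p.1, p.2.1), S.h (p.1, p.2.2)), S.f (S.g (p.1, p.2.1), p.1))

/-- Covariates and two pairs of treatment and outcome with common covariates. -/
def negPair (e : Vec k × ((Vec m × Vec d) × (Vec m × Vec d))) :
    Vec k × ((Vec D × Vec m) × (Vec D × Vec m)) :=
  (S.l e.1, (S.unit (S.l e.1, e.2.1), S.unit (S.l e.1, e.2.2)))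

/-- The noises that yield a positive pair. -/
def posEvent : Set ((Vec k × Vec m) × (Vec d × Vec d)) :=
  S.posPair ⁻¹' {p | p.2.1 ≠ p.2.2}

/-- The noises that yield a negative pair. -/
def negEvent : Set (Vec k × ((Vec m × Vec d) × (Vec m × Vec d))) :=
  S.negPair ⁻¹' {p | p.2.1.1 ≠ p.2.2.1 ∧ p.2.1.2 ≠ p.2.2.2}

variable {S}

lemma Regular.continuous_causal (hS : S.Regular) : Continuous S.causal := by
  have := hS.l_diffeo.1.continuous
  have := hS.g_smooth.continuous
  unfold causal
  fun_prop

lemma Regular.continuous_posPair (hS : S.Regular) : Continuous S.posPair := by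
  have := hS.l_diffeo.1.continuous
  have := hS.continuous_causal
  have := hS.h_smooth.continuous
  have := hS.f_smooth.continuous
  have := hS.mix_diffeo.1.continuous
  unfold posPair
  fun_prop

lemma Regular.continuous_unit (hS : S.Regular) : Continuous S.unit := by
  have := hS.g_smooth.continuous
  have := hS.h_smooth.continuous
  have := hS.f_smooth.continuous
  have := hS.mix_diffeo.1.continuous
  unfold unit
  fun_prop

lemma Regular.continuous_negPair (hS : S.Regular) : Continuous S.negPair := by
  have := hS.l_diffeo.1.continuous
  have := hS.continuous_unit
  unfold negPair
  fun_prop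

lemma _root_.IsSmoothDiffeo.injective {E F : Type*} [NormedAddCommGroup E] [NormedSpace ℝ E]
    [NormedAddCommGroup F] [NormedSpace ℝ F] {f : E → F} (hf : IsSmoothDiffeo f) :
    Function.Injective f := by
  obtain ⟨_, _, _, hl, _⟩ := hf
  exact hl.injective

lemma _root_.IsSmoothDiffeo.surjective {E F : Type*} [NormedAddCommGroup E] [NormedSpace ℝ E]
    [NormedAddCommGroup F] [NormedSpace ℝ F] {f : E → F} (hf : IsSmoothDiffeo f) :
    Function.Surjective f := by
  obtain ⟨_, _, _, _, hr⟩ := hf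
  exact hr.surjective

lemma Regular.mix_injective (hS : S.Regular) : Function.Injective S.mix := by
  obtain ⟨_, _, _, hl⟩ := hS.mix_diffeo
  exact hl.injective

lemma Regular.injective_posPair (hS : S.Regular) : Function.Injective S.posPair := by
  rintro ⟨⟨x, c⟩, n, n'⟩ ⟨⟨x₁, c₁⟩, n₁, n₁'⟩ h
  simp only [posPair, Prod.mk.injEq] at h
  obtain ⟨⟨hx, -⟩, hn, hn'⟩ := h
  obtain rfl := hS.l_diffeo.injective hx
  obtain ⟨hc, hh⟩ := Prod.mk.inj (hS.mix_injective hn)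
  obtain ⟨-, hh'⟩ := Prod.mk.inj (hS.mix_injective hn')
  obtain rfl := (hS.g_diffeo _).injective hc
  obtain rfl := (hS.h_diffeo _).injective hh
  obtain rfl := (hS.h_diffeo _).injective hh'
  rfl

lemma Regular.injective_negPair (hS : S.Regular) : Function.Injective S.negPair := by
  rintro ⟨x, ⟨c, n⟩, c', n'⟩ ⟨x₁, ⟨c₁, n₁⟩, c₁', n₁'⟩ h
  simp only [negPair, unit, Prod.mk.injEq] at h
  obtain ⟨hx, ⟨hn, -⟩, hn', -⟩ := h
  obtain rfl := hS.l_diffeo.injective hx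
  obtain ⟨hc, hh⟩ := Prod.mk.inj (hS.mix_injective hn)
  obtain ⟨hc', hh'⟩ := Prod.mk.inj (hS.mix_injective hn')
  obtain rfl := (hS.g_diffeo _).injective hc
  obtain rfl := (hS.g_diffeo _).injective hc'
  obtain rfl := (hS.h_diffeo _).injective hh
  obtain rfl := (hS.h_diffeo _).injective hh'
  rfl

lemma Regular.isOpen_posEvent (hS : S.Regular) : IsOpen S.posEvent :=
  (isOpen_ne_fun (by fun_prop) (by fun_prop)).preimage hS.continuous_posPair

lemma Regular.isOpen_negEvent (hS : S.Regular) : IsOpen S.negEvent :=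
  ((isOpen_ne_fun (by fun_prop) (by fun_prop)).inter
    (isOpen_ne_fun (by fun_prop) (by fun_prop))).preimage hS.continuous_negPair

lemma Regular.isOpenPosMeasure_posNoiseLaw (hS : S.Regular) :
    S.posNoiseLaw.IsOpenPosMeasure := by
  have := hS.noiseX_law.isOpenPosMeasure
  have := hS.noiseC_law.isOpenPosMeasure
  have := hS.noiseN_law.isOpenPosMeasure
  unfold posNoiseLaw
  exact Measure.prod.instIsOpenPosMeasure

lemma Regular.isOpenPosMeasure_negNoiseLaw (hS : S.Regular) :
    S.negNoiseLaw.IsOpenPosMeasure := by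
  have := hS.noiseX_law.isOpenPosMeasure
  have := hS.noiseC_law.isOpenPosMeasure
  have := hS.noiseN_law.isOpenPosMeasure
  have : ((S.noiseC : Measure (Vec m)).prod (S.noiseN : Measure (Vec d))).IsOpenPosMeasure :=
    Measure.prod.instIsOpenPosMeasure
  have : (((S.noiseC : Measure (Vec m)).prod (S.noiseN : Measure (Vec d))).prod
      ((S.noiseC : Measure (Vec m)).prod (S.noiseN : Measure (Vec d)))).IsOpenPosMeasure :=
    Measure.prod.instIsOpenPosMeasure
  unfold negNoiseLaw
  exact Measure.prod.instIsOpenPosMeasure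

/-- Conditioning on `(X, Y)` amounts to conditioning on `X` and `T_C`: the continuous inverse `φ`
recovers `T_C` from `(X, Y)`, so only the non-causal noise is drawn twice. -/
lemma Regular.posPairLaw_eq (hS : S.Regular) :
    S.posPairLaw = (ProbabilityTheory.cond S.posNoiseLaw S.posEvent).map S.posPair := by
  obtain ⟨φ, hφ, hφl, -⟩ := exists_continuous_parametric_inverse hS.f_smooth hS.f_diffeo
  have hmeas : MeasurableSet {p : (Vec k × Vec m) × (Vec D × Vec D) | p.2.1 ≠ p.2.2} :=
    (isOpen_ne_fun (by fun_prop) (by fun_prop)).measurableSet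
  have hl := hS.l_diffeo.1.continuous
  have hf := hS.f_smooth.continuous
  have hh := hS.h_smooth.continuous
  have hmix := hS.mix_diffeo.1.continuous
  have hc := hS.continuous_causal
  rw [posPairLaw, posEvent, ← cond_map_of_measurable hS.continuous_posPair.measurable hmeas,
    compProd_condDistrib_prod_self S.noiseLaw
      ((S.noiseX : Measure (Vec k)).prod (S.noiseC : Measure (Vec m)))
      (S.noiseN : Measure (Vec d))
      (α := MeasurableEquiv.prodAssoc.symm)
      (q := fun p => (S.l p.1, S.f (S.causal p, S.l p.1)))
      (u := fun p => S.mix (φ p.1, S.h (p.1.1, p.2)))]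
  · simp only [hφl]
    rfl
  · exact (measurePreserving_prodAssoc _ _ _).symm _
  · exact Continuous.measurable (by fun_prop)
  · exact Continuous.measurable (by fun_prop)
  · exact fun e => rfl
  · rintro ⟨x, c, n⟩
    simp only [Y, T, hφl]
    rfl

lemma Regular.negPairLaw_eq (hS : S.Regular) :
    S.negPairLaw = (ProbabilityTheory.cond S.negNoiseLaw S.negEvent).map S.negPair := by
  have hmeas : MeasurableSet {p : Vec k × ((Vec D × Vec m) × (Vec D × Vec m)) |
      p.2.1.1 ≠ p.2.2.1 ∧ p.2.1.2 ≠ p.2.2.2} :=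
    ((isOpen_ne_fun (by fun_prop) (by fun_prop)).inter
      (isOpen_ne_fun (by fun_prop) (by fun_prop))).measurableSet
  rw [negPairLaw, negEvent, ← cond_map_of_measurable hS.continuous_negPair.measurable hmeas,
    compProd_condDistrib_prod_self S.noiseLaw (S.noiseX : Measure (Vec k))
      ((S.noiseC : Measure (Vec m)).prod (S.noiseN : Measure (Vec d)))
      (α := id) (MeasurePreserving.id _) (q := S.l) hS.l_diffeo.1.continuous.measurable
      (u := S.unit) hS.continuous_unit.measurable]
  · rfl
  · exact fun e => rfl
  · exact fun e => rfl

/-- `F` may be non-measurable, since a representation is arbitrary off the treatment space. This is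
why injectivity of `posPair` matters: it makes the continuous map a measurable embedding. -/
lemma Regular.lintegral_posPairLaw (hS : S.Regular)
    (F : (Vec k × Vec m) × (Vec D × Vec D) → ℝ≥0∞) :
    ∫⁻ p, F p ∂S.posPairLaw =
      ∫⁻ e, F (S.posPair e) ∂(ProbabilityTheory.cond S.posNoiseLaw S.posEvent) := by
  rw [hS.posPairLaw_eq,
    (hS.continuous_posPair.measurableEmbedding hS.injective_posPair).lintegral_map]

lemma Regular.lintegral_negPairLaw (hS : S.Regular)
    (F : Vec k × ((Vec D × Vec m) × (Vec D × Vec m)) → ℝ≥0∞) :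
    ∫⁻ p, F p ∂S.negPairLaw =
      ∫⁻ e, F (S.negPair e) ∂(ProbabilityTheory.cond S.negNoiseLaw S.negEvent) := by
  rw [hS.negPairLaw_eq,
    (hS.continuous_negPair.measurableEmbedding hS.injective_negPair).lintegral_map]

end PairLaws

/-! ### Consequences of zero loss, and the loss under scaling. -/

section Loss

variable {k m d D r : ℕ} {S : TreatmentSCM k m d D} {a : ℝ≥0 → ℝ≥0}
  {b : Vec k × Vec m × Vec m × ℝ≥0 → ℝ≥0} {ψ : Vec D → Vec r}

lemma continuous_comp_mix (hS : S.Regular) (hψ : ContDiffOn ℝ ∞ ψ (range S.mix)) :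
    Continuous fun z => ψ (S.mix z) :=
  hψ.continuousOn.comp_continuous hS.mix_diffeo.1.continuous fun z => mem_range_self z

/-- A smooth representation of zero loss is a function of the causal latents. -/
lemma eq_of_contrastiveLoss_eq_zero (hS : S.Regular) (ha : IsAttraction a)
    (hψ : ContDiffOn ℝ ∞ ψ (range S.mix)) (h : S.contrastiveLoss a b ψ = 0) (c : Vec m)
    (n n' : Vec d) : ψ (S.mix (c, n)) = ψ (S.mix (c, n')) := by
  by_contra hne
  have h0 := (add_eq_zero.1 h).1
  rw [hS.lintegral_posPairLaw] at h0
  have := hS.isOpenPosMeasure_posNoiseLaw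
  -- Any covariate value would do; at covariate noise `0` suitable noises realize all the given
  -- latents.
  obtain ⟨ec, rfl⟩ := (hS.g_diffeo (S.l 0)).surjective c
  obtain ⟨en, rfl⟩ := (hS.h_diffeo (S.l 0)).surjective n
  obtain ⟨en', rfl⟩ := (hS.h_diffeo (S.l 0)).surjective n'
  have hψc := continuous_comp_mix hS hψ
  have hl := hS.l_diffeo.1.continuous
  have hh := hS.h_smooth.continuous
  have hc := hS.continuous_causal
  have hac := ha.continuous
  have hz := eq_zero_of_lintegral_cond_eq_zero hS.isOpen_posEvent (e := ((0, ec), (en, en'))) (by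
      simp only [posPair]
      refine ENNReal.continuous_coe.comp (hac.comp (Continuous.nndist ?_ ?_))
      · exact hψc.comp (by fun_prop)
      · exact hψc.comp (by fun_prop)) h0 (fun he => hne (congrArg ψ he))
  rw [ENNReal.coe_eq_zero, ha.eq_zero_iff, nndist_eq_zero] at hz
  exact hne hz

/-- A smooth representation of zero loss separates the causal latents, if the loss penalizes
collapsed negative pairs. -/
lemma ne_of_contrastiveLoss_eq_zero (hS : S.Regular) (hb : S.IsRepulsion b)
    (hbp : PenalizesCollapse b) (hψ : ContDiffOn ℝ ∞ ψ (range S.mix))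
    (h : S.contrastiveLoss a b ψ = 0) {c c' : Vec m} (hcc : c ≠ c') (n n' : Vec d) :
    ψ (S.mix (c, n)) ≠ ψ (S.mix (c', n')) := by
  intro heq
  have h0 := (add_eq_zero.1 h).2
  rw [hS.lintegral_negPairLaw] at h0
  have := hS.isOpenPosMeasure_negNoiseLaw
  have hy : S.f (c, S.l 0) ≠ S.f (c', S.l 0) := fun hy => hcc ((hS.f_diffeo _).injective hy)
  have ht : S.mix (c, n) ≠ S.mix (c', n') := fun ht =>
    hcc (congrArg Prod.fst (hS.mix_injective ht))
  have hpos := hbp (S.l 0) _ _ hy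
  obtain ⟨ec, rfl⟩ := (hS.g_diffeo (S.l 0)).surjective c
  obtain ⟨ec', rfl⟩ := (hS.g_diffeo (S.l 0)).surjective c'
  obtain ⟨en, rfl⟩ := (hS.h_diffeo (S.l 0)).surjective n
  obtain ⟨en', rfl⟩ := (hS.h_diffeo (S.l 0)).surjective n'
  have hψc := continuous_comp_mix hS hψ
  have hl := hS.l_diffeo.1.continuous
  have hh := hS.h_smooth.continuous
  have hg := hS.g_smooth.continuous
  have hf := hS.f_smooth.continuous
  have hbc := hb.continuous
  have hz := eq_zero_of_lintegral_cond_eq_zero hS.isOpen_negEvent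
    (e := (0, ((ec, en), (ec', en')))) (by
      simp only [negPair, unit]
      refine ENNReal.continuous_coe.comp (hbc.comp ?_)
      refine Continuous.prodMk (by fun_prop) (Continuous.prodMk (by fun_prop)
        (Continuous.prodMk (by fun_prop) (Continuous.nndist ?_ ?_)))
      · exact hψc.comp (by fun_prop)
      · exact hψc.comp (by fun_prop)) h0 ⟨ht, hy⟩
  rw [ENNReal.coe_eq_zero] at hz
  simp only [negPair, unit] at hz
  rw [nndist_eq_zero.2 heq] at hz
  exact hpos.ne' hz

/-- The loss of a representation that reproduces the distances of the causal latents up to a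
factor. -/
lemma contrastiveLoss_of_scaling (hS : S.Regular) (ha : IsAttraction a) {s : ℝ≥0}
    (hψ : ∀ c n c' n', nndist (ψ (S.mix (c, n))) (ψ (S.mix (c', n'))) = s * nndist c c') :
    S.contrastiveLoss a b ψ =
      ∫⁻ e, (b (S.l e.1, S.f (S.causal (e.1, e.2.1.1), S.l e.1),
          S.f (S.causal (e.1, e.2.2.1), S.l e.1),
          s * nndist (S.causal (e.1, e.2.1.1)) (S.causal (e.1, e.2.2.1))) : ℝ≥0∞)
        ∂(ProbabilityTheory.cond S.negNoiseLaw S.negEvent) := by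
  rw [contrastiveLoss, hS.lintegral_posPairLaw, hS.lintegral_negPairLaw]
  simp only [posPair, negPair, unit, hψ, nndist_self, mul_zero, (ha.eq_zero_iff 0).2 rfl,
    ENNReal.coe_zero, lintegral_zero, zero_add, causal]

lemma tendsto_contrastiveLoss_of_scaling (hS : S.Regular) (ha : IsAttraction a)
    (hb : S.IsRepulsion b) {ψ : ℕ → Vec D → Vec r}
    (hψ : ∀ j c n c' n', nndist (ψ j (S.mix (c, n))) (ψ j (S.mix (c', n'))) =
      ((j : ℝ≥0) + 1) * nndist c c') :
    Tendsto (fun j => S.contrastiveLoss a b (ψ j)) atTop (𝓝 0) := by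
  simp only [contrastiveLoss_of_scaling hS ha (hψ _)]
  have hl := hS.l_diffeo.1.continuous
  have hf := hS.f_smooth.continuous
  have hc := hS.continuous_causal
  have hbc := hb.continuous
  have hint := hb.integrable
  rw [hS.lintegral_negPairLaw] at hint
  rw [← lintegral_zero (μ := ProbabilityTheory.cond S.negNoiseLaw S.negEvent)]
  refine tendsto_lintegral_of_dominated_convergence _ (fun j => ?_) (fun j => ?_) hint ?_
  · exact (ENNReal.continuous_coe.comp (hbc.comp (by fun_prop))).measurable
  · exact Eventually.of_forall fun e => ENNReal.coe_le_coe.2 (hb.antitone _ _ _ zero_le)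
  -- Distinct outcomes at a common `X` force distinct causal latents, so the scaled distances
  -- diverge.
  · refine ae_cond_of_forall_mem hS.isOpen_negEvent.measurableSet fun e he => ?_
    have hy : S.f (S.causal (e.1, e.2.1.1), S.l e.1) ≠ S.f (S.causal (e.1, e.2.2.1), S.l e.1) :=
      he.2
    have hcc : S.causal (e.1, e.2.1.1) ≠ S.causal (e.1, e.2.2.1) := fun h => hy (by rw [h])
    rw [← ENNReal.coe_zero, ENNReal.tendsto_coe]
    refine (hb.tendsto _ _ _ hy).comp ?_
    have hlim : Tendsto (fun j : ℕ => (j : ℝ) + 1) atTop atTop :=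
      tendsto_atTop_add_const_right _ _ tendsto_natCast_atTop_atTop
    refine NNReal.tendsto_coe_atTop.1 ?_
    simp only [NNReal.coe_mul, NNReal.coe_add, NNReal.coe_natCast, NNReal.coe_one, coe_nndist]
    exact hlim.atTop_mul_const (dist_pos.2 hcc)

end Loss

/-! ### Competitors, encoders and an attained minimum. -/

section Representations

variable {k m d D r : ℕ} {S : TreatmentSCM k m d D} {a : ℝ≥0 → ℝ≥0}
  {b : Vec k × Vec m × Vec m × ℝ≥0 → ℝ≥0}

lemma exists_smooth_scaling_representation (hS : S.Regular) (hr : m ≤ r) (s : ℝ≥0) :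
    ∃ ψ : Vec D → Vec r, ContDiffOn ℝ ∞ ψ (range S.mix) ∧
      ∀ c n c' n', nndist (ψ (S.mix (c, n))) (ψ (S.mix (c', n'))) = s * nndist c c' := by
  obtain ⟨-, u, hu, hul⟩ := hS.mix_diffeo
  replace hul : ∀ z, u (S.mix z) = z := hul
  refine ⟨fun t => (s : ℝ) • vecEmbedding hr (u t).1, ?_, fun c n c' n' => ?_⟩
  · exact ((vecEmbedding hr).contDiff.comp_contDiffOn
      (contDiff_fst.comp_contDiffOn hu)).const_smul (s : ℝ)
  · simp only [hul]
    rw [nndist_smul₀, (vecEmbedding hr).isometry.nndist_eq]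
    simp

lemma exists_invertible_scaling_encoder (hS : S.Regular) {s : ℝ≥0} (hs : s ≠ 0) :
    ∃ Ψ : Vec D → Vec m × Vec d, S.IsInvertibleEncoder Ψ ∧
      ∀ c n c' n', nndist (Ψ (S.mix (c, n))).1 (Ψ (S.mix (c', n'))).1 = s * nndist c c' := by
  obtain ⟨hmix, u, hu, hul⟩ := hS.mix_diffeo
  replace hul : ∀ z, u (S.mix z) = z := hul
  have hs' : (s : ℝ) ≠ 0 := by exact_mod_cast hs
  refine ⟨fun t => ((s : ℝ) • (u t).1, (u t).2), ⟨?_, fun z => S.mix ((s : ℝ)⁻¹ • z.1, z.2), ?_,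
    fun z => mem_range_self _, fun z => ?_, ?_⟩, fun c n c' n' => ?_⟩
  · exact ((contDiff_fst.comp_contDiffOn hu).const_smul (s : ℝ)).prodMk
      (contDiff_snd.comp_contDiffOn hu)
  · exact hmix.comp ((contDiff_fst.const_smul (s : ℝ)⁻¹).prodMk contDiff_snd)
  · simp only [hul, smul_inv_smul₀ hs']
  · rintro _ ⟨z, rfl⟩
    simp only [hul, inv_smul_smul₀ hs']
  · simp only [hul]
    rw [nndist_smul₀]
    simp

/-- Precomposing the encoder with `mix` gives a diffeomorphism of `ℝ^m × ℝ^d`, to which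
`bijective_of_fst_block` applies. -/
lemma bijective_of_encoder_fst (hS : S.Regular) {Ψ : Vec D → Vec m × Vec d}
    (hΨ : S.IsInvertibleEncoder Ψ) {φ : Vec m → Vec m}
    (hφ : ∀ c n, (Ψ (S.mix (c, n))).1 = φ c) : Function.Bijective φ := by
  obtain ⟨hΨs, Θ, hΘ, hΘr, hΨΘ, hΘΨ⟩ := hΨ
  obtain ⟨hmix, u, hu, hul⟩ := hS.mix_diffeo
  refine bijective_of_fst_block (Γ := fun z => Ψ (S.mix z)) (G := fun z => u (Θ z))
    ?_ ?_ (fun z => ?_) (fun z => ?_) hφ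
  · exact hΨs.comp_contDiff hmix fun z => mem_range_self z
  · exact hu.comp_contDiff hΘ hΘr
  · simp only [hΘΨ _ (mem_range_self z), hul z]
  · obtain ⟨w, hw⟩ := hΘr z
    simp only [← hw, hul w]
    rw [hw, hΨΘ]

/-- A repulsion that vanishes as soon as the representations of a negative pair are as distant as
their causal latents. -/
lemma exists_repulsion (hS : S.Regular) :
    ∃ b : Vec k × Vec m × Vec m × ℝ≥0 → ℝ≥0, S.IsRepulsion b ∧ PenalizesCollapse b ∧
      ∀ x c c', b (x, S.f (c, x), S.f (c', x), nndist c c') = 0 := by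
  obtain ⟨φ, hφ, hφl, hφr⟩ := exists_continuous_parametric_inverse hS.f_smooth hS.f_diffeo
  -- The subtraction is truncated at zero. The cap at `1` gives a finite mean and makes the penalty
  -- vanish for every `t ≥ 1`.
  refine ⟨fun p => min 1 (nndist (φ (p.1, p.2.1)) (φ (p.1, p.2.2.1))) - p.2.2.2,
    ⟨by fun_prop, fun x y y' t t' h => tsub_le_tsub_left h _, fun x y y' _ => ?_, ?_⟩,
    fun x y y' hy => ?_, fun x c c' => ?_⟩
  · refine tendsto_const_nhds.congr' ?_
    filter_upwards [eventually_ge_atTop 1] with t ht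
    exact (tsub_eq_zero_of_le ((min_le_left _ _).trans ht)).symm
  · rw [hS.lintegral_negPairLaw]
    refine ((lintegral_mono (g := fun _ => 1) fun e => ?_).trans_lt ?_).ne
    · exact ENNReal.coe_le_one_iff.2 <| tsub_le_self.trans (min_le_left _ _)
    · rw [lintegral_const, one_mul]
      exact measure_lt_top _ _
  · simp only [tsub_zero]
    refine lt_min one_pos (pos_iff_ne_zero.2 fun h => hy ?_)
    rw [← hφr x y, ← hφr x y', nndist_eq_zero.1 h]
  · simp only [hφl]
    exact tsub_eq_zero_of_le (min_le_right _ _)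

lemma IsContrastiveMinimizer.contrastiveLoss_eq_zero (hS : S.Regular) (ha : IsAttraction a)
    (hb : S.IsRepulsion b) (hr : m ≤ r) {ψ : Vec D → Vec r}
    (hψ : S.IsContrastiveMinimizer a b ψ) : S.contrastiveLoss a b ψ = 0 := by
  choose ψ' hs hψ' using fun j : ℕ =>
    exists_smooth_scaling_representation hS hr ((j : ℝ≥0) + 1)
  exact le_zero_iff.1 (ge_of_tendsto' (tendsto_contrastiveLoss_of_scaling hS ha hb hψ')
    fun j => hψ.2 _ (hs j))

lemma IsInvertibleContrastiveMinimizer.contrastiveLoss_eq_zero (hS : S.Regular)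
    (ha : IsAttraction a) (hb : S.IsRepulsion b) {Ψ : Vec D → Vec m × Vec d}
    (hΨ : S.IsInvertibleContrastiveMinimizer a b Ψ) :
    S.contrastiveLoss a b (fun t => (Ψ t).1) = 0 := by
  choose Ψ' hs hΨ' using fun j : ℕ =>
    -- The shift by one keeps the factor nonzero at `j = 0`, as invertibility requires.
    exists_invertible_scaling_encoder hS (s := (j : ℝ≥0) + 1) (by positivity)
  exact le_zero_iff.1 (ge_of_tendsto'
    (tendsto_contrastiveLoss_of_scaling (ψ := fun j t => (Ψ' j t).1) hS ha hb hΨ')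
    fun j => hΨ.2 _ (hs j))

lemma contrastiveLoss_eq_zero_of_isometric (hS : S.Regular) (ha : IsAttraction a)
    (hb : ∀ x c c', b (x, S.f (c, x), S.f (c', x), nndist c c') = 0) {ψ : Vec D → Vec r}
    (hψ : ∀ c n c' n', nndist (ψ (S.mix (c, n))) (ψ (S.mix (c', n'))) = 1 * nndist c c') :
    S.contrastiveLoss a b ψ = 0 := by
  rw [contrastiveLoss_of_scaling hS ha hψ]
  simp [hb]

end Representations

end TreatmentSCM

end


theorem theorem3 {k m d D : ℕ} (S : TreatmentSCM k m d D) (hS : S.Regular) :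
    (∀ (a : ℝ≥0 → ℝ≥0) (b : Vec k × Vec m × Vec m × ℝ≥0 → ℝ≥0),
      TreatmentSCM.IsAttraction a → S.IsRepulsion b →
        (TreatmentSCM.PenalizesCollapse b → ∀ r : ℕ, m ≤ r → ∀ ψ : Vec D → Vec r,
          S.IsContrastiveMinimizer a b ψ → S.BlockIdentifies ψ) ∧
        (∀ Ψ : Vec D → Vec m × Vec d, S.IsInvertibleContrastiveMinimizer a b Ψ →
          ∃ φ : Vec m → Vec m, Function.Bijective φ ∧ ∀ c n, (Ψ (S.mix (c, n))).1 = φ c)) ∧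
    (∃ b : Vec k × Vec m × Vec m × ℝ≥0 → ℝ≥0,
      S.IsRepulsion b ∧ TreatmentSCM.PenalizesCollapse b ∧
        ∀ a : ℝ≥0 → ℝ≥0, TreatmentSCM.IsAttraction a →
          (∀ r : ℕ, m ≤ r → ∃ ψ : Vec D → Vec r, S.IsContrastiveMinimizer a b ψ) ∧
          ∃ Ψ : Vec D → Vec m × Vec d, S.IsInvertibleContrastiveMinimizer a b Ψ) := by
  refine ⟨fun a b ha hb => ⟨fun hbp r hr ψ hψ => ?_, fun Ψ hΨ => ?_⟩, ?_⟩
  · have h0 := hψ.contrastiveLoss_eq_zero hS ha hb hr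
    refine ⟨fun c => ψ (S.mix (c, 0)), fun c c' h => ?_, fun c n =>
      TreatmentSCM.eq_of_contrastiveLoss_eq_zero hS ha hψ.1 h0 c n 0⟩
    by_contra hne
    exact TreatmentSCM.ne_of_contrastiveLoss_eq_zero hS hb hbp hψ.1 h0 hne 0 0 h
  · have h0 := hΨ.contrastiveLoss_eq_zero hS ha hb
    have hφ : ∀ c n, (Ψ (S.mix (c, n))).1 = (Ψ (S.mix (c, 0))).1 := fun c n =>
      TreatmentSCM.eq_of_contrastiveLoss_eq_zero hS ha
        (contDiff_fst.comp_contDiffOn hΨ.1.1) h0 c n 0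
    exact ⟨fun c => (Ψ (S.mix (c, 0))).1, TreatmentSCM.bijective_of_encoder_fst hS hΨ.1 hφ, hφ⟩
  · obtain ⟨b, hb, hbp, hb0⟩ := TreatmentSCM.exists_repulsion hS
    refine ⟨b, hb, hbp, fun a ha => ⟨fun r hr => ?_, ?_⟩⟩
    · obtain ⟨ψ, hψs, hψ⟩ := TreatmentSCM.exists_smooth_scaling_representation hS hr 1
      refine ⟨ψ, hψs, fun ψ' _ => ?_⟩
      rw [TreatmentSCM.contrastiveLoss_eq_zero_of_isometric hS ha hb0 hψ]
      exact zero_le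
    · obtain ⟨Ψ, hΨs, hΨ⟩ := TreatmentSCM.exists_invertible_scaling_encoder hS one_ne_zero
      refine ⟨Ψ, hΨs, fun Ψ' _ => ?_⟩
      rw [TreatmentSCM.contrastiveLoss_eq_zero_of_isometric (ψ := fun t => (Ψ t).1) hS ha hb0 hΨ]
      exact zero_le
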